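/- Let $\tilde\Omega=\{(s,a,c)\in\mathbb C^3: 0<\Re(a)<1,\ 0<\Re(c)<1\}$ be the extended fundamental polycylinder. The Lerch zeta function $$\zeta(s,a,c)=\sum_{n=0}^{\infty}\frac{e^{2\pi i n a}}{(n+c)^{s}},$$ where the series converges absolutely at the points of $\tilde\Omega$ with $\Im(a)>0$ (with the principal branch of the power), extends to a unique holomorphic function of three variables on $\tilde\Omega$, again denoted $\zeta(s,a,c)$. (Extended Lerch Transformation Formula) For all $(s,a,c)\in\tilde\Omega$, $$\zeta(1-s,a,c)=(2\pi)^{-s}\,\Gamma(s)\left[e^{\frac{\pi i s}{2}}e^{-2\pi i a c}\,\zeta(s,1-c,a)+e^{-\frac{\pi i s}{2}}e^{2\pi i c(1-a)}\,\zeta(s,c,1-a)\right].$$ At the poles $s=0,-1,-2,\dots$ of $\Gamma(s)$, the right-hand side has a removable singularity as a function of $(s,a,c)\in\tilde\Omega$, and the formula is understood there with its limit in place of the right-hand side. -/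

import Mathlib

open Complex Filter Topology

/-- The extended fundamental polycylinder: all triples `(s, a, c)` of complex numbers with
`0 < Re a < 1` and `0 < Re c < 1`. -/
def extendedPolycylinder : Set (ℂ × ℂ × ℂ) :=
  {p | (0 < p.2.1.re ∧ p.2.1.re < 1) ∧ (0 < p.2.2.re ∧ p.2.2.re < 1)}

/-- `Z` is an analytic continuation of the Lerch zeta function to the extended fundamental
polycylinder: it is holomorphic there as a function of three complex variables and it is the sum of
the Lerch Dirichlet series `∑ exp (2 π i n a) / (n + c) ^ s` (principal branch of the power) where
`Im a > 0`, in which region the series converges absolutely. -/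
def IsLerchContinuation (Z : ℂ × ℂ × ℂ → ℂ) : Prop :=
  DifferentiableOn ℂ Z extendedPolycylinder ∧
    ∀ s a c : ℂ, (s, a, c) ∈ extendedPolycylinder → 0 < a.im →
      HasSum (fun n : ℕ => exp (2 * Real.pi * I * n * a) / ((n : ℂ) + c) ^ s) (Z (s, a, c))

/-- The Lerch zeta function on the extended fundamental polycylinder, as an analytic continuation
of the Lerch Dirichlet series. (Existence of the continuation, and uniqueness of its values on
the extended fundamental polycylinder, are part of the theorem, not of this definition. The values
outside the extended fundamental polycylinder have no meaning.) -/
noncomputable def lerchZeta (s a c : ℂ) : ℂ :=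
  Classical.epsilon IsLerchContinuation (s, a, c)

/-- The right-hand side of the Lerch transformation formula. -/
noncomputable def lerchTransform (s a c : ℂ) : ℂ :=
  (2 * Real.pi : ℂ) ^ (-s) * Gamma s *
    (exp (Real.pi * I * s / 2) * exp (-2 * Real.pi * I * a * c) * lerchZeta s (1 - c) a +
      exp (-(Real.pi * I * s / 2)) * exp (2 * Real.pi * I * c * (1 - a)) * lerchZeta s c (1 - a))

open MeasureTheory Set
open scoped FourierTransform


/-! With $q=e^{2\pi i a}$ the series is $\sum q^n(n+c)^{-s}$. For $\Re s>0$ and $|q|<1$, expanding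
$1/(1-qe^{-t})$ shows that $\Gamma(s)$ times it is `lerchMellin`. That integral is holomorphic for
every $q\notin[1,\infty)$ (`differentiableAt_lerchMellin`), hence for all $0<\Re a<1$, which
continues the series to $\Re s>0$.

The formula comes from Poisson summation for $y_+^{s-1}e^{2\pi i a y}$, whose Fourier transform is
$\Gamma(s)(2\pi i(x-a))^{-s}$. Its translates sum to the series at $1-s$; frequencies $n\le 0$ and
$n\ge 1$ give the two terms on the right (`lerchSeries_eq_lerchDual_of_one_lt_re`). The identity
theorem extends this from $\Re s>1$, real $c$ to $\Re s>0$, complex $c$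
(`lerchSeries_eq_lerchDual`).

The right-hand side, written with Mellin integrals (`lerchDual`), is holomorphic for $\Re s>0$, so
at $1-s$ it continues the series to $\Re s<1$. The two continuations agree for $0<\Re s<1$ and glue
to `lerchContinuation`. Divided by $\Gamma(s)$, the formula relates entire functions of $s$ that
agree on $\Re s>0$, hence everywhere. -/

/-! ### Holomorphy of the Mellin integral. -/

/-- The integrand of the Mellin integral of `exp (-c t) / (1 - q exp (-t))`, with parameters
`p = (s, q, c)`. -/
noncomputable def lerchKernel (p : ℂ × ℂ × ℂ) (t : ℝ) : ℂ :=
  (t : ℂ) ^ (p.1 - 1) * exp (-p.2.2 * t) / (1 - p.2.1 * exp (-t))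

/-- The Mellin integral `∫ t ^ (s - 1) exp (-c t) / (1 - q exp (-t))` over the positive half-line,
with parameters `p = (s, q, c)`. -/
noncomputable def lerchMellin (p : ℂ × ℂ × ℂ) : ℂ :=
  ∫ t in Ioi (0 : ℝ), lerchKernel p t

/-- The complement of $[1,\infty)$ is star-shaped about $0$. -/
lemma one_sub_mul_mem_slitPlane {q : ℂ} (hq : 1 - q ∈ slitPlane) {u : ℝ} (hu : u ∈ Icc (0 : ℝ) 1) :
    1 - q * u ∈ slitPlane := by
  rw [mem_slitPlane_iff] at hq ⊢
  simp only [sub_re, one_re, sub_im, one_im, mul_re, mul_im, ofReal_re, ofReal_im, mul_zero,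
    zero_sub, sub_zero, zero_add, neg_ne_zero] at hq ⊢
  obtain ⟨h0, h1⟩ := hu
  rcases hq with hq | hq
  · left
    rcases h1.eq_or_lt with h | h
    · simpa [h] using hq
    · nlinarith
  · rcases h0.eq_or_lt with h | h
    · left; simp [← h]
    · right; simp [hq, h.ne']

lemma one_sub_mul_exp_neg_ne_zero {q : ℂ} (hq : 1 - q ∈ slitPlane) {t : ℝ} (ht : 0 ≤ t) :
    1 - q * exp (-t) ≠ 0 := by
  have := one_sub_mul_mem_slitPlane hq (u := Real.exp (-t))
    ⟨(Real.exp_pos _).le, Real.exp_le_one_iff.2 (by linarith)⟩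
  push_cast at this
  exact slitPlane_ne_zero this

/-- Substituting $u=e^{-t}\in[0,1]$ makes the half-line part of a compact interval, so compactness
gives one bound for all $t$ and all nearby $q$. -/
lemma exists_norm_inv_one_sub_mul_exp_neg_le {q₀ : ℂ} (hq : 1 - q₀ ∈ slitPlane) :
    ∃ r > 0, ∃ C > 0, ∀ q ∈ Metric.ball q₀ r, 1 - q ∈ slitPlane ∧
      ∀ t : ℝ, 0 ≤ t → ‖(1 - q * exp (-t))⁻¹‖ ≤ C := by
  have hopen : IsOpen {q : ℂ | 1 - q ∈ slitPlane} :=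
    isOpen_slitPlane.preimage (by fun_prop)
  obtain ⟨r, hr, hsub⟩ := Metric.nhds_basis_closedBall.mem_iff.1 (hopen.mem_nhds hq)
  have hK : IsCompact (Metric.closedBall q₀ r ×ˢ Icc (0 : ℝ) 1) :=
    (isCompact_closedBall _ _).prod isCompact_Icc
  have hcont : ContinuousOn (fun p : ℂ × ℝ => ‖(1 - p.1 * (p.2 : ℂ))⁻¹‖)
      (Metric.closedBall q₀ r ×ˢ Icc (0 : ℝ) 1) := by
    refine (ContinuousOn.inv₀ (by fun_prop) ?_).norm
    rintro ⟨q, u⟩ ⟨h1, h2⟩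
    exact slitPlane_ne_zero (one_sub_mul_mem_slitPlane (hsub h1) h2)
  obtain ⟨C, hC⟩ := hK.bddAbove_image hcont
  refine ⟨r, hr, max C 1, by positivity, fun q hq => ⟨hsub (Metric.ball_subset_closedBall hq),
    fun t ht => le_max_of_le_left (hC ⟨(q, Real.exp (-t)), ⟨Metric.ball_subset_closedBall hq,
      (Real.exp_pos _).le, Real.exp_le_one_iff.2 (by linarith)⟩, by simp⟩)⟩⟩

lemma integrableOn_rpow_mul_exp_neg_mul {p b : ℝ} (hp : -1 < p) (hb : 0 < b) :
    IntegrableOn (fun t : ℝ => t ^ p * Real.exp (-b * t)) (Ioi 0) := by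
  simpa using integrableOn_rpow_mul_exp_neg_mul_rpow hp one_pos hb

/-- The derivative of `lerchKernel` in its parameters. -/
noncomputable def lerchKernelDeriv (p : ℂ × ℂ × ℂ) (t : ℝ) : ℂ × ℂ × ℂ →L[ℂ] ℂ :=
  lerchKernel p t • ((Real.log t : ℂ) • ContinuousLinearMap.fst ℂ ℂ (ℂ × ℂ) +
    ((exp (-t) * (1 - p.2.1 * exp (-t))⁻¹) •
      (ContinuousLinearMap.fst ℂ ℂ ℂ).comp (ContinuousLinearMap.snd ℂ ℂ (ℂ × ℂ)) -
    (t : ℂ) • (ContinuousLinearMap.snd ℂ ℂ ℂ).comp (ContinuousLinearMap.snd ℂ ℂ (ℂ × ℂ))))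

lemma hasFDerivAt_lerchKernel {p : ℂ × ℂ × ℂ} (hq : 1 - p.2.1 ∈ slitPlane) {t : ℝ} (ht : 0 < t) :
    HasFDerivAt (fun p => lerchKernel p t) (lerchKernelDeriv p t) p := by
  have ht' : (t : ℂ) ≠ 0 := ofReal_ne_zero.2 ht.ne'
  have h1 : HasFDerivAt (fun p : ℂ × ℂ × ℂ => p.1 - 1) (ContinuousLinearMap.fst ℂ ℂ (ℂ × ℂ)) p :=
    hasFDerivAt_fst.sub_const 1
  have h2 : HasFDerivAt (fun p : ℂ × ℂ × ℂ => p.2.1) _ p :=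
    ((ContinuousLinearMap.fst ℂ ℂ ℂ).comp (ContinuousLinearMap.snd ℂ ℂ (ℂ × ℂ))).hasFDerivAt
  have h3 : HasFDerivAt (fun p : ℂ × ℂ × ℂ => p.2.2) _ p :=
    ((ContinuousLinearMap.snd ℂ ℂ ℂ).comp (ContinuousLinearMap.snd ℂ ℂ (ℂ × ℂ))).hasFDerivAt
  have hne := one_sub_mul_exp_neg_ne_zero hq ht.le
  have h4 := (h1.const_cpow (c := (t : ℂ)) (Or.inl ht')).mul (h3.neg.mul_const (t : ℂ)).cexp
  have h5 := h4.mul ((hasDerivAt_inv hne).comp_hasFDerivAt p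
    ((h2.mul_const (exp (-t))).const_sub 1))
  refine (h5.congr_fderiv ?_).congr_of_eventuallyEq (.of_forall fun p => ?_)
  · ext <;> simp [lerchKernelDeriv, lerchKernel, ofReal_log ht.le] <;> field_simp
  · simp [lerchKernel, div_eq_mul_inv]

lemma continuousOn_lerchKernel {p : ℂ × ℂ × ℂ} (hq : 1 - p.2.1 ∈ slitPlane) :
    ContinuousOn (lerchKernel p) (Ioi 0) := by
  unfold lerchKernel
  refine ContinuousOn.div (ContinuousOn.mul (fun t ht => ?_) (by fun_prop)) (by fun_prop)
    fun t ht => one_sub_mul_exp_neg_ne_zero hq (le_of_lt ht)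
  exact (continuousAt_ofReal_cpow_const _ _ (Or.inr (ne_of_gt ht))).continuousWithinAt

lemma continuousOn_lerchKernelDeriv {p : ℂ × ℂ × ℂ} (hq : 1 - p.2.1 ∈ slitPlane) :
    ContinuousOn (lerchKernelDeriv p) (Ioi 0) := by
  have h1 : ContinuousOn (fun t : ℝ => (Real.log t : ℂ)) (Ioi 0) :=
    continuous_ofReal.comp_continuousOn (Real.continuousOn_log.mono fun t ht => ne_of_gt ht)
  have h2 : ContinuousOn (fun t : ℝ => (1 - p.2.1 * exp (-t))⁻¹) (Ioi 0) :=
    ContinuousOn.inv₀ (by fun_prop) fun t ht => one_sub_mul_exp_neg_ne_zero hq (le_of_lt ht)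
  have h3 : ContinuousOn (fun t : ℝ => exp (-t) * (1 - p.2.1 * exp (-t))⁻¹) (Ioi 0) :=
    ContinuousOn.mul (by fun_prop) h2
  have h4 : ContinuousOn (fun t : ℝ => (t : ℂ)) (Ioi 0) := by fun_prop
  exact (continuousOn_lerchKernel hq).smul ((h1.smul continuousOn_const).add
    ((h3.smul continuousOn_const).sub (h4.smul continuousOn_const)))

lemma norm_lerchKernel {p : ℂ × ℂ × ℂ} {t : ℝ} (ht : 0 < t) :
    ‖lerchKernel p t‖ = t ^ (p.1.re - 1) * Real.exp (-p.2.2.re * t) *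
      ‖(1 - p.2.1 * exp (-t))⁻¹‖ := by
  rw [lerchKernel, div_eq_mul_inv, norm_mul, norm_mul, norm_cpow_eq_rpow_re_of_pos ht, norm_exp]
  simp

lemma norm_lerchKernelDeriv_le (p : ℂ × ℂ × ℂ) {t : ℝ} (ht : 0 < t) :
    ‖lerchKernelDeriv p t‖ ≤
      ‖lerchKernel p t‖ * (|Real.log t| + (‖(1 - p.2.1 * exp (-t))⁻¹‖ + t)) := by
  unfold lerchKernelDeriv
  rw [norm_smul]
  gcongr
  have f1 := ContinuousLinearMap.norm_fst_le ℂ ℂ (ℂ × ℂ)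
  have f2 := ContinuousLinearMap.norm_fst_le ℂ ℂ ℂ
  have f3 := ContinuousLinearMap.norm_snd_le ℂ ℂ (ℂ × ℂ)
  have f4 := ContinuousLinearMap.norm_snd_le ℂ ℂ ℂ
  refine (norm_add_le _ _).trans (add_le_add ?_ ((norm_sub_le _ _).trans (add_le_add ?_ ?_)))
  · rw [norm_smul, norm_real, Real.norm_eq_abs]
    exact mul_le_of_le_one_right (abs_nonneg _) f1
  · rw [norm_smul, norm_mul]
    have h : ‖exp (-t)‖ ≤ 1 := by simp [norm_exp, ht.le]
    calc _ ≤ 1 * ‖(1 - p.2.1 * exp (-t))⁻¹‖ * (1 * 1) := by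
          gcongr
          exact (ContinuousLinearMap.opNorm_comp_le _ _).trans (by gcongr)
      _ = _ := by ring
  · rw [norm_smul, norm_real, Real.norm_eq_abs, abs_of_pos ht]
    exact mul_le_of_le_one_right ht.le ((ContinuousLinearMap.opNorm_comp_le _ _).trans
      (mul_le_one₀ f4 (norm_nonneg _) f3))

/-- Absorbs into powers of $t$ the logarithm produced by differentiating $t^{s-1}$ in $s$. -/
lemma abs_log_le_rpow_add {t ε : ℝ} (ht : 0 < t) (hε : 0 < ε) :
    |Real.log t| ≤ t ^ ε / ε + t ^ (-ε) / ε := by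
  have h1 := Real.log_le_rpow_div ht.le hε
  have h2 := Real.log_le_rpow_div (inv_pos.2 ht).le hε
  rw [Real.log_inv, Real.inv_rpow ht.le, ← Real.rpow_neg ht.le] at h2
  have : 0 ≤ t ^ ε / ε := by positivity
  have : 0 ≤ t ^ (-ε) / ε := by positivity
  rw [abs_le]
  constructor <;> linarith

lemma integrableOn_lerchKernel {p : ℂ × ℂ × ℂ} (hs : 0 < p.1.re) (hq : 1 - p.2.1 ∈ slitPlane)
    (hc : 0 < p.2.2.re) : IntegrableOn (lerchKernel p) (Ioi 0) := by
  obtain ⟨r, hr, C, -, h⟩ := exists_norm_inv_one_sub_mul_exp_neg_le hq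
  refine Integrable.mono' ((integrableOn_rpow_mul_exp_neg_mul (p := p.1.re - 1) (by linarith)
    hc).mul_const C) ((continuousOn_lerchKernel hq).aestronglyMeasurable measurableSet_Ioi)
    ((ae_restrict_mem measurableSet_Ioi).mono fun t ht => ?_)
  rw [norm_lerchKernel ht]
  have ht' : 0 < t := ht
  gcongr
  exact (h _ (Metric.mem_ball_self hr)).2 t ht'.le

lemma differentiableAt_lerchMellin {p : ℂ × ℂ × ℂ} (hs : 0 < p.1.re)
    (hq : 1 - p.2.1 ∈ slitPlane) (hc : 0 < p.2.2.re) : DifferentiableAt ℂ lerchMellin p := by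
  obtain ⟨r, hr, C, hC, h⟩ := exists_norm_inv_one_sub_mul_exp_neg_le hq
  -- Near `p` the real part of the exponent stays in $(3\varepsilon,5\varepsilon)$; the logarithm
  -- costs another $\varepsilon$, so the worst power is $t^{2\varepsilon-1}$, still integrable at
  -- $0$.
  set ε := p.1.re / 4 with hε
  set b := p.2.2.re / 2 with hb
  have hε0 : 0 < ε := by positivity
  have hb0 : 0 < b := by positivity
  set ρ := min r (min ε b)
  have hρ : 0 < ρ := by positivity
  have hball : ∀ x ∈ Metric.ball p ρ, (3 * ε < x.1.re ∧ x.1.re < 5 * ε) ∧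
      x.2.1 ∈ Metric.ball p.2.1 r ∧ b < x.2.2.re := by
    intro x hx
    rw [mem_ball_iff_norm] at hx
    have h1 := (norm_fst_le (x - p)).trans_lt hx
    have h2 := (norm_snd_le (x - p)).trans_lt hx
    have h3 := (norm_fst_le (x - p).2).trans_lt h2
    have h4 := (norm_snd_le (x - p).2).trans_lt h2
    have h5 := (abs_re_le_norm _).trans_lt h1
    have h6 := (abs_re_le_norm _).trans_lt h4
    simp only [Prod.fst_sub, Prod.snd_sub, sub_re] at h3 h5 h6
    rw [mem_ball_iff_norm]
    have l1 : ρ ≤ r := min_le_left _ _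
    have l2 : ρ ≤ ε := (min_le_right _ _).trans (min_le_left _ _)
    have l3 : ρ ≤ b := (min_le_right _ _).trans (min_le_right _ _)
    rw [abs_lt] at h5 h6
    refine ⟨⟨by linarith, by linarith⟩, by linarith, by linarith⟩
  set bound : ℝ → ℝ := fun t => (t ^ (3 * ε - 1) + t ^ (5 * ε - 1)) * Real.exp (-b * t) * C *
    ((t ^ ε / ε + t ^ (-ε) / ε) + (C + t)) with hbound
  have hint : IntegrableOn bound (Ioi 0) := by
    have I : ∀ x : ℝ, -1 < x → IntegrableOn (fun t : ℝ => t ^ x * Real.exp (-b * t)) (Ioi 0) :=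
      fun x hx => integrableOn_rpow_mul_exp_neg_mul hx hb0
    have J : IntegrableOn (fun t : ℝ => C / ε * (t ^ (4 * ε - 1) * Real.exp (-b * t)) +
        C / ε * (t ^ (6 * ε - 1) * Real.exp (-b * t)) +
        (C / ε * (t ^ (2 * ε - 1) * Real.exp (-b * t)) +
        C / ε * (t ^ (4 * ε - 1) * Real.exp (-b * t))) +
        (C * C * (t ^ (3 * ε - 1) * Real.exp (-b * t)) +
        C * C * (t ^ (5 * ε - 1) * Real.exp (-b * t))) +
        (C * (t ^ (3 * ε) * Real.exp (-b * t)) +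
        C * (t ^ (5 * ε) * Real.exp (-b * t)))) (Ioi 0) := by
      refine Integrable.add (Integrable.add (Integrable.add (Integrable.add ?_ ?_)
        (Integrable.add ?_ ?_)) (Integrable.add ?_ ?_)) (Integrable.add ?_ ?_) <;>
      exact (I _ (by linarith)).const_mul _
    refine J.congr_fun (fun t ht => ?_) measurableSet_Ioi
    have ht' : 0 < t := ht
    have e1 : t ^ (4 * ε - 1) = t ^ (3 * ε - 1) * t ^ ε := by
      rw [← Real.rpow_add ht']; ring_nf
    have e2 : t ^ (6 * ε - 1) = t ^ (5 * ε - 1) * t ^ ε := by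
      rw [← Real.rpow_add ht']; ring_nf
    have e3 : t ^ (2 * ε - 1) = t ^ (3 * ε - 1) * t ^ (-ε) := by
      rw [← Real.rpow_add ht']; ring_nf
    have e4 : t ^ (5 * ε - 1) * t ^ (-ε) = t ^ (3 * ε - 1) * t ^ ε := by
      rw [← Real.rpow_add ht', ← Real.rpow_add ht']; ring_nf
    have e5 : t ^ (3 * ε) = t ^ (3 * ε - 1) * t := by
      rw [Real.rpow_sub_one ht'.ne']; field_simp
    have e6 : t ^ (5 * ε) = t ^ (5 * ε - 1) * t := by
      rw [Real.rpow_sub_one ht'.ne']; field_simp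
    simp only [hbound]
    rw [e1, e2, e3, e5, e6]
    linear_combination (-(C / ε * Real.exp (-b * t))) * e4
  refine (hasFDerivAt_integral_of_dominated_of_fderiv_le (F' := lerchKernelDeriv) (bound := bound)
    (Metric.ball_mem_nhds p hρ) ?_ (integrableOn_lerchKernel hs hq hc)
    ((continuousOn_lerchKernelDeriv hq).aestronglyMeasurable measurableSet_Ioi) ?_ hint
    ?_).differentiableAt
  · filter_upwards [Metric.ball_mem_nhds p hρ] with x hx
    exact (continuousOn_lerchKernel (h _ (hball x hx).2.1).1).aestronglyMeasurable measurableSet_Ioi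
  · refine (ae_restrict_mem measurableSet_Ioi).mono fun t ht x hx => ?_
    have ht' : 0 < t := ht
    obtain ⟨⟨b1, b2⟩, b3, b4⟩ := hball x hx
    have hinv := (h _ b3).2 t ht'.le
    refine (norm_lerchKernelDeriv_le x ht).trans ?_
    rw [norm_lerchKernel ht]
    have hpow : t ^ (x.1.re - 1) ≤ t ^ (3 * ε - 1) + t ^ (5 * ε - 1) := by
      rcases le_total t 1 with h1 | h1
      · exact (Real.rpow_le_rpow_of_exponent_ge ht' h1 (by linarith)).trans
          (le_add_of_nonneg_right (by positivity))
      · exact (Real.rpow_le_rpow_of_exponent_le h1 (by linarith)).trans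
          (le_add_of_nonneg_left (by positivity))
    have hlog := abs_log_le_rpow_add ht' hε0
    simp only [hbound]
    gcongr
  · exact (ae_restrict_mem measurableSet_Ioi).mono fun t ht x hx =>
      hasFDerivAt_lerchKernel (h _ (hball x hx).2.1).1 ht

/-! ### Expansion of the Mellin integral in a Lerch series. -/

lemma one_sub_zero_mem_slitPlane : (1 - 0 : ℂ) ∈ slitPlane := by simp

/-- Lets the identity theorem start from agreement at real points only. -/
lemma frequently_ofReal_nhdsNE (x : ℝ) {P : ℂ → Prop} (h : ∀ᶠ y : ℝ in 𝓝 x, P y) :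
    ∃ᶠ z in 𝓝[≠] (x : ℂ), P z := by
  have h1 : Tendsto (fun y : ℝ => (y : ℂ)) (𝓝[≠] x) (𝓝[≠] (x : ℂ)) := by
    refine tendsto_nhdsWithin_iff.2 ⟨(continuous_ofReal.tendsto x).mono_left nhdsWithin_le_nhds, ?_⟩
    exact eventually_mem_nhdsWithin.mono fun y hy => by simpa using hy
  exact h1.frequently (h.filter_mono nhdsWithin_le_nhds).frequently

lemma isOpen_re_pos : IsOpen {z : ℂ | 0 < z.re} := isOpen_lt continuous_const continuous_re

lemma isPreconnected_re_pos : IsPreconnected {z : ℂ | 0 < z.re} :=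
  (convex_halfSpace_re_gt 0).isPreconnected

/-- The Gamma integral with a complex scaling parameter. -/
lemma lerchMellin_zero {s c : ℂ} (hs : 0 < s.re) (hc : 0 < c.re) :
    lerchMellin (s, 0, c) = c ^ (-s) * Gamma s := by
  have hf : DifferentiableOn ℂ (fun c : ℂ => lerchMellin (s, 0, c)) {z | 0 < z.re} := by
    intro z hz
    exact (DifferentiableAt.comp (g := lerchMellin) (f := fun c : ℂ => (s, (0 : ℂ), c)) z
      (differentiableAt_lerchMellin (p := (s, 0, z)) hs
      one_sub_zero_mem_slitPlane hz)
      (by fun_prop)).differentiableWithinAt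
  have hg : DifferentiableOn ℂ (fun c : ℂ => c ^ (-s) * Gamma s) {z | 0 < z.re} := by
    intro z hz
    exact ((differentiableAt_id.cpow_const (Or.inl hz)).mul_const _).differentiableWithinAt
  refine (hf.analyticOnNhd isOpen_re_pos).eqOn_of_preconnected_of_frequently_eq
    (hg.analyticOnNhd isOpen_re_pos) isPreconnected_re_pos (z₀ := ((1 : ℝ) : ℂ)) (by simp)
    (frequently_ofReal_nhdsNE 1 ?_) hc
  filter_upwards [lt_mem_nhds zero_lt_one] with r hr
  have := integral_cpow_mul_exp_neg_mul_Ioi hs hr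
  rw [one_div, inv_cpow _ _ (by rw [arg_ofReal_of_nonneg hr.le]; exact Real.pi_pos.ne),
    ← cpow_neg] at this
  rw [← this]
  simp [lerchMellin, lerchKernel]

lemma integral_norm_lerchKernel_zero {s c : ℂ} (hs : 0 < s.re) (hc : 0 < c.re) :
    ∫ t in Ioi (0 : ℝ), ‖lerchKernel (s, 0, c) t‖ = c.re ^ (-s.re) * Real.Gamma s.re := by
  have := Real.integral_rpow_mul_exp_neg_mul_Ioi hs hc
  rw [one_div, Real.inv_rpow hc.le, ← Real.rpow_neg hc.le] at this
  rw [← this]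
  refine setIntegral_congr_fun measurableSet_Ioi fun t ht => ?_
  simp [norm_lerchKernel ht]

/-- Geometric series; $|q|=1$ is allowed because $e^{-t}<1$, and the Fourier side needs that case.
-/
lemma hasSum_lerchKernel (s c : ℂ) {q : ℂ} (hq : ‖q‖ ≤ 1) {t : ℝ} (ht : 0 < t) :
    HasSum (fun n : ℕ => q ^ n * lerchKernel (s, 0, n + c) t) (lerchKernel (s, q, c) t) := by
  have h1 : ‖q * exp (-t)‖ < 1 := by
    rw [norm_mul, norm_exp]
    have : Real.exp ((-(t : ℂ)).re) < 1 := by simpa using ht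
    nlinarith [norm_nonneg q, Real.exp_pos ((-(t : ℂ)).re)]
  convert! (hasSum_geometric_of_norm_lt_one h1).mul_left ((t : ℂ) ^ (s - 1) * exp (-c * t))
    using 2 with n
  simp only [lerchKernel, zero_mul, sub_zero, div_one, mul_pow, ← Complex.exp_nat_mul]
  rw [show -((n : ℂ) + c) * t = -c * t + n * -t by ring, Complex.exp_add]
  ring

/-- The Mellin integral as a Lerch series, when the series of absolute values converges. -/
lemma hasSum_lerchMellin {s q c : ℂ} (hs : 0 < s.re) (hc : 0 < c.re) (hq : ‖q‖ ≤ 1)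
    (hsum : Summable fun n : ℕ => ‖q‖ ^ n * ((n : ℝ) + c.re) ^ (-s.re)) :
    HasSum (fun n : ℕ => q ^ n * (((n : ℂ) + c) ^ (-s) * Gamma s)) (lerchMellin (s, q, c)) := by
  have hcn : ∀ n : ℕ, 0 < ((n : ℂ) + c).re := fun n => by simp; positivity
  have hint : ∀ n : ℕ, IntegrableOn (fun t => q ^ n * lerchKernel (s, 0, n + c) t) (Ioi 0) :=
    fun n => (integrableOn_lerchKernel (p := (s, 0, n + c)) hs one_sub_zero_mem_slitPlane
      (hcn n)).const_mul _
  have key := hasSum_integral_of_summable_integral_norm hint (by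
    convert! hsum.mul_right (Real.Gamma s.re) using 2 with n
    simp only [norm_mul, norm_pow]
    rw [integral_const_mul, integral_norm_lerchKernel_zero hs (hcn n)]
    simp [mul_assoc])
  convert! key using 2 with n
  · rw [integral_const_mul, ← lerchMellin_zero hs (hcn n), lerchMellin]
  · exact setIntegral_congr_fun measurableSet_Ioi fun t ht =>
      (hasSum_lerchKernel s c hq ht).tsum_eq.symm

/-! ### Convergence and holomorphy of the Lerch series. -/

/-- A bound for the powers in the Lerch series that is uniform in the exponent and the shift. -/
lemma norm_natCast_add_cpow_neg_le {s c : ℂ} {K : ℕ} {B : ℝ} (hs : ‖s‖ ≤ K) (hB : 1 ≤ B)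
    (hc : B⁻¹ ≤ c.re) (hcB : ‖c‖ ≤ B) (n : ℕ) :
    ‖((n : ℂ) + c) ^ (-s)‖ ≤ B ^ K * Real.exp (Real.pi * K) * ((n : ℝ) + 1) ^ K := by
  have hB0 : 0 < B := by linarith
  have hre : B⁻¹ ≤ ((n : ℂ) + c).re := by simp; linarith [n.cast_nonneg (α := ℝ)]
  have hlow : B⁻¹ ≤ ‖(n : ℂ) + c‖ := hre.trans (re_le_norm _)
  have hpos : 0 < ‖(n : ℂ) + c‖ := (inv_pos.2 hB0).trans_le hlow
  have hn1 : (1 : ℝ) ≤ n + 1 := by linarith [n.cast_nonneg (α := ℝ)]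
  have hup : ‖(n : ℂ) + c‖ ≤ B * (n + 1) := by
    refine (norm_add_le _ _).trans ?_
    rw [norm_natCast]
    nlinarith [n.cast_nonneg (α := ℝ)]
  have hBn : 1 ≤ B * ((n : ℝ) + 1) := by nlinarith
  have hre_s := abs_le.1 ((abs_re_le_norm s).trans hs)
  -- Since $B^{-1}\le|n+c|\le B(n+1)$, both $|n+c|$ and its inverse are at most $B(n+1)$, which
  -- covers either sign of the exponent.
  have hpow : ‖(n : ℂ) + c‖ ^ (-s.re) ≤ (B * (n + 1)) ^ K := by
    rw [← Real.rpow_natCast]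
    rcases le_total 0 (-s.re) with h | h
    · exact (Real.rpow_le_rpow hpos.le hup h).trans
        (Real.rpow_le_rpow_of_exponent_le hBn (by linarith))
    · rw [Real.rpow_neg hpos.le, ← Real.inv_rpow hpos.le]
      refine (Real.rpow_le_rpow (by positivity) ?_ (by linarith)).trans
        (Real.rpow_le_rpow_of_exponent_le hBn (by linarith))
      refine (inv_le_of_inv_le₀ hB0 hlow).trans ?_
      nlinarith
  refine (norm_cpow_le _ _).trans ?_
  rw [div_eq_mul_inv, ← Real.exp_neg, neg_im, neg_re]
  calc _ ≤ (B * ((n : ℝ) + 1)) ^ K * Real.exp (Real.pi * K) := by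
        gcongr
        refine (le_abs_self _).trans ?_
        rw [mul_neg, neg_neg, abs_mul]
        gcongr
        · exact abs_arg_le_pi _
        · exact (abs_im_le_norm s).trans hs
    _ = _ := by rw [mul_pow]; ring

lemma summable_geometric_mul_add_one_pow {r : ℝ} (h0 : 0 < r) (h1 : r < 1) (K : ℕ) :
    Summable fun n : ℕ => r ^ n * ((n : ℝ) + 1) ^ K := by
  have := (summable_nat_add_iff 1).2
    (summable_pow_mul_geometric_of_norm_lt_one K (r := r) (by simpa [abs_of_pos h0] using h1))
  convert! this.mul_right r⁻¹ using 2 with n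
  push_cast
  field_simp
  ring

lemma summable_geometric_mul_rpow {r x : ℝ} (σ : ℝ) (h0 : 0 < r) (h1 : r < 1) (hx : 0 < x) :
    Summable fun n : ℕ => r ^ n * ((n : ℝ) + x) ^ (-σ) := by
  obtain ⟨K, hK⟩ := exists_nat_ge ‖(σ : ℂ)‖
  set B := max 1 (max x x⁻¹)
  have hB : 1 ≤ B := le_max_left _ _
  have hxB : x ≤ B := (le_max_left _ _).trans (le_max_right _ _)
  have hxB' : B⁻¹ ≤ x :=
    inv_le_of_inv_le₀ hx ((le_max_right _ _).trans (le_max_right _ _))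
  refine .of_nonneg_of_le (fun n => by positivity) (fun n => ?_)
    ((summable_geometric_mul_add_one_pow h0 h1 K).mul_left (B ^ K * Real.exp (Real.pi * K)))
  have := norm_natCast_add_cpow_neg_le (c := (x : ℂ)) hK hB (by simpa using hxB')
    (by simpa [abs_of_pos hx] using hxB) n
  rw [← ofReal_natCast, ← ofReal_add, ← ofReal_neg,
    norm_cpow_eq_rpow_re_of_pos (by positivity), ofReal_re] at this
  calc _ ≤ r ^ n * (B ^ K * Real.exp (Real.pi * K) * ((n : ℝ) + 1) ^ K) := by gcongr
    _ = _ := by ring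

/-- The Lerch series in terms of `q = exp (2 π i a)`. -/
noncomputable def lerchSeries (s q c : ℂ) : ℂ := ∑' n : ℕ, q ^ n * ((n : ℂ) + c) ^ (-s)

lemma norm_lerchSeries_term_le {s q c : ℂ} {K : ℕ} {B : ℝ} (hs : ‖s‖ ≤ K) (hB : 1 ≤ B)
    (hc : B⁻¹ ≤ c.re) (hcB : ‖c‖ ≤ B) (n : ℕ) :
    ‖q ^ n * ((n : ℂ) + c) ^ (-s)‖ ≤
      B ^ K * Real.exp (Real.pi * K) * (‖q‖ ^ n * ((n : ℝ) + 1) ^ K) := by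
  rw [norm_mul, norm_pow]
  calc _ ≤ ‖q‖ ^ n * (B ^ K * Real.exp (Real.pi * K) * ((n : ℝ) + 1) ^ K) := by
        gcongr; exact norm_natCast_add_cpow_neg_le hs hB hc hcB n
    _ = _ := by ring

lemma exists_bound_of_re_pos {c : ℂ} (hc : 0 < c.re) : ∃ B : ℝ, 1 ≤ B ∧ B⁻¹ < c.re ∧ ‖c‖ < B := by
  refine ⟨1 + ‖c‖ + c.re⁻¹, by linarith [norm_nonneg c, inv_pos.2 hc], ?_,
    by linarith [norm_nonneg c, inv_pos.2 hc]⟩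
  exact inv_lt_of_inv_lt₀ hc (by linarith [norm_nonneg c, inv_pos.2 hc])

lemma natCast_add_mem_slitPlane {c : ℂ} (hc : 0 < c.re) (n : ℕ) : (n : ℂ) + c ∈ slitPlane := by
  left; simp; positivity

lemma summable_lerchSeries (s : ℂ) {q c : ℂ} (hq0 : q ≠ 0) (hq : ‖q‖ < 1) (hc : 0 < c.re) :
    Summable fun n : ℕ => q ^ n * ((n : ℂ) + c) ^ (-s) := by
  obtain ⟨K, hK⟩ := exists_nat_ge ‖s‖
  obtain ⟨B, hB, h1, h2⟩ := exists_bound_of_re_pos hc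
  exact .of_norm_bounded ((summable_geometric_mul_add_one_pow (norm_pos_iff.2 hq0) hq K).mul_left _)
    (norm_lerchSeries_term_le hK hB h1.le h2.le)

lemma differentiable_lerchSeries_exponent {q c : ℂ} (hq0 : q ≠ 0) (hq : ‖q‖ < 1)
    (hc : 0 < c.re) : Differentiable ℂ fun s => lerchSeries s q c := by
  intro s
  obtain ⟨K, hK⟩ := exists_nat_gt ‖s‖
  obtain ⟨B, hB, h1, h2⟩ := exists_bound_of_re_pos hc
  have hopen : IsOpen {z : ℂ | ‖z‖ < K} := isOpen_lt continuous_norm continuous_const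
  refine (differentiableOn_tsum_of_summable_norm
    ((summable_geometric_mul_add_one_pow (norm_pos_iff.2 hq0) hq K).mul_left
      (B ^ K * Real.exp (Real.pi * K))) (fun n => ?_) hopen
    (fun n z hz => norm_lerchSeries_term_le (le_of_lt hz) hB h1.le h2.le n)).differentiableAt
    (hopen.mem_nhds hK)
  intro z hz
  exact ((differentiableAt_id.neg.const_cpow
    (Or.inl (slitPlane_ne_zero (natCast_add_mem_slitPlane hc n)))).const_mul
      _).differentiableWithinAt

lemma differentiableOn_lerchSeries_shift (s : ℂ) {q : ℂ} (hq0 : q ≠ 0) (hq : ‖q‖ < 1) :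
    DifferentiableOn ℂ (fun c => lerchSeries s q c) {c | 0 < c.re} := by
  intro c hc
  obtain ⟨K, hK⟩ := exists_nat_ge ‖s‖
  obtain ⟨B, hB, h1, h2⟩ := exists_bound_of_re_pos hc
  have hopen : IsOpen {z : ℂ | B⁻¹ < z.re ∧ ‖z‖ < B} :=
    (isOpen_lt continuous_const continuous_re).inter (isOpen_lt continuous_norm continuous_const)
  refine ((differentiableOn_tsum_of_summable_norm
    ((summable_geometric_mul_add_one_pow (norm_pos_iff.2 hq0) hq K).mul_left
      (B ^ K * Real.exp (Real.pi * K))) (fun n => ?_) hopen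
    (fun n z hz => norm_lerchSeries_term_le hK hB hz.1.le hz.2.le n)).differentiableAt
    (hopen.mem_nhds ⟨h1, h2⟩)).differentiableWithinAt
  intro z hz
  have hz0 : 0 < z.re := (inv_pos.2 (by linarith)).trans hz.1
  exact (((differentiableAt_id.const_add _).cpow_const
    (natCast_add_mem_slitPlane hz0 n)).const_mul _).differentiableWithinAt

lemma lerchMellin_eq_lerchSeries {s q c : ℂ} (hs : 0 < s.re) (hq0 : q ≠ 0) (hq : ‖q‖ < 1)
    (hc : 0 < c.re) : lerchMellin (s, q, c) = Gamma s * lerchSeries s q c := by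
  rw [← (hasSum_lerchMellin hs hc hq.le
    (summable_geometric_mul_rpow s.re (norm_pos_iff.2 hq0) hq hc)).tsum_eq, lerchSeries,
    ← tsum_mul_left]
  exact tsum_congr fun n => by ring

lemma hasSum_lerchMellin_of_one_lt_re {s q c : ℂ} (hs : 1 < s.re) (hc : 0 < c.re) (hq : ‖q‖ = 1) :
    HasSum (fun n : ℕ => q ^ n * (((n : ℂ) + c) ^ (-s) * Gamma s)) (lerchMellin (s, q, c)) := by
  refine hasSum_lerchMellin (by linarith) hc hq.le ?_
  convert! (Real.summable_one_div_nat_add_rpow c.re s.re).2 hs using 2 with n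
  rw [hq, one_pow, one_mul, abs_of_pos (by positivity), Real.rpow_neg (by positivity), one_div]

/-! ### The nome and the branches of the power. -/

/-- The nome `exp (2 π i a)`. -/
noncomputable def lerchNome (a : ℂ) : ℂ := exp (2 * Real.pi * I * a)

lemma lerchNome_ne_zero (a : ℂ) : lerchNome a ≠ 0 := exp_ne_zero _

lemma norm_lerchNome (a : ℂ) : ‖lerchNome a‖ = Real.exp (-(2 * Real.pi * a.im)) := by
  simp [lerchNome, norm_exp]

lemma norm_lerchNome_lt_one {a : ℂ} (ha : 0 < a.im) : ‖lerchNome a‖ < 1 := by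
  rw [norm_lerchNome, Real.exp_lt_one_iff]
  have := Real.pi_pos
  simp; positivity

lemma lerchNome_pow (a : ℂ) (n : ℕ) : lerchNome a ^ n = exp (2 * Real.pi * I * n * a) := by
  rw [lerchNome, ← Complex.exp_nat_mul]; ring_nf

/-- For $0<\Re a<1$ the nome is real only when $\Re a=1/2$, and then it is negative, so it never
meets $[1,\infty)$. -/
lemma one_sub_lerchNome_mem_slitPlane {a : ℂ} (h0 : 0 < a.re) (h1 : a.re < 1) :
    1 - lerchNome a ∈ slitPlane := by
  rw [mem_slitPlane_iff]
  by_contra! h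
  have hre : (lerchNome a).re = Real.exp (-(2 * Real.pi * a.im)) * Real.cos (2 * (Real.pi * a.re)) := by
    simp [lerchNome, exp_re, mul_assoc]
  have him : (lerchNome a).im = Real.exp (-(2 * Real.pi * a.im)) * Real.sin (2 * (Real.pi * a.re)) := by
    simp [lerchNome, exp_im, mul_assoc]
  have hsin : 0 < Real.sin (Real.pi * a.re) :=
    Real.sin_pos_of_pos_of_lt_pi (by have := Real.pi_pos; positivity) (by nlinarith [Real.pi_pos])
  have hE := Real.exp_pos (-(2 * Real.pi * a.im))
  obtain ⟨h2, h3⟩ := h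
  rw [sub_re, one_re, hre, Real.cos_two_mul] at h2
  rw [sub_im, one_im, zero_sub, neg_eq_zero, him, Real.sin_two_mul] at h3
  have hcos : Real.cos (Real.pi * a.re) = 0 := by simpa [hE.ne', hsin.ne'] using h3
  rw [hcos] at h2
  nlinarith

/-- As $|\arg w|<\pi/2$, adding $\arg i=\pi/2$ does not cross the cut and the principal logarithm is
additive. This and the conjugate case below produce the factors $e^{\mp\pi i s/2}$. -/
lemma two_pi_I_mul_cpow_neg {w : ℂ} (hw : 0 < w.re) (s : ℂ) :
    (2 * Real.pi * I * w) ^ (-s) =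
      (2 * Real.pi : ℂ) ^ (-s) * exp (-(Real.pi * I * s / 2)) * w ^ (-s) := by
  have hw0 : w ≠ 0 := by rintro rfl; simp at hw
  have harg := abs_lt.1 (abs_arg_lt_pi_div_two_iff.2 (Or.inl hw))
  have hpi := Real.pi_pos
  have h2pi : (2 * Real.pi : ℂ) ≠ 0 := by simp [hpi.ne']
  have hlog : log (2 * Real.pi * I * w) = log (2 * Real.pi) + (Real.pi / 2 * I + log w) := by
    rw [show (2 * Real.pi * I * w : ℂ) = ((2 * Real.pi : ℝ) : ℂ) * (I * w) by push_cast; ring,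
      log_ofReal_mul (by positivity) (mul_ne_zero I_ne_zero hw0), ofReal_log (by positivity),
      log_mul I_ne_zero hw0, log_I]
    · push_cast; ring
    · rw [arg_I]; constructor <;> linarith
  rw [cpow_def_of_ne_zero (by simp [hpi.ne', hw0]), cpow_def_of_ne_zero h2pi,
    cpow_def_of_ne_zero hw0, hlog, ← Complex.exp_add, ← Complex.exp_add]
  ring_nf

lemma neg_two_pi_I_mul_cpow_neg {w : ℂ} (hw : 0 < w.re) (s : ℂ) :
    (-(2 * Real.pi * I * w)) ^ (-s) =
      (2 * Real.pi : ℂ) ^ (-s) * exp (Real.pi * I * s / 2) * w ^ (-s) := by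
  have hw0 : w ≠ 0 := by rintro rfl; simp at hw
  have harg := abs_lt.1 (abs_arg_lt_pi_div_two_iff.2 (Or.inl hw))
  have hpi := Real.pi_pos
  have h2pi : (2 * Real.pi : ℂ) ≠ 0 := by simp [hpi.ne']
  have hlog : log (-(2 * Real.pi * I * w)) = log (2 * Real.pi) + (-(Real.pi / 2) * I + log w) := by
    rw [show (-(2 * Real.pi * I * w) : ℂ) = ((2 * Real.pi : ℝ) : ℂ) * (-I * w) by push_cast; ring,
      log_ofReal_mul (by positivity) (mul_ne_zero (neg_ne_zero.2 I_ne_zero) hw0),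
      ofReal_log (by positivity), log_mul (neg_ne_zero.2 I_ne_zero) hw0, log_neg_I]
    · push_cast; ring
    · rw [arg_neg_I]; constructor <;> linarith
  rw [cpow_def_of_ne_zero (by simp [hpi.ne', hw0]), cpow_def_of_ne_zero h2pi,
    cpow_def_of_ne_zero hw0, hlog, ← Complex.exp_add, ← Complex.exp_add]
  ring_nf

/-! ### Poisson summation. -/

/-- The one-sided function whose Poisson summation gives the Lerch transformation formula. -/
noncomputable def lerchPoisson (s a : ℂ) (y : ℝ) : ℂ :=
  ((max y 0 : ℝ) : ℂ) ^ (s - 1) * exp (2 * Real.pi * I * a * y)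

lemma lerchPoisson_of_nonpos {s : ℂ} (hs : 1 < s.re) (a : ℂ) {y : ℝ} (hy : y ≤ 0) :
    lerchPoisson s a y = 0 := by
  have : s - 1 ≠ 0 := fun h => by
    have := congrArg re h
    simp at this; linarith
  simp [lerchPoisson, max_eq_right hy, zero_cpow this]

lemma continuous_lerchPoisson {s : ℂ} (hs : 1 < s.re) (a : ℂ) :
    Continuous (lerchPoisson s a) := by
  unfold lerchPoisson
  refine Continuous.mul ?_ (by fun_prop)
  exact (continuous_ofReal_cpow_const (y := s - 1) (by simpa using hs)).comp
    (continuous_id.max continuous_const)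

lemma isBigO_lerchPoisson {s a : ℂ} (hs : 1 < s.re) (ha : 0 < a.im) :
    lerchPoisson s a =O[cocompact ℝ] fun x => |x| ^ (-2 : ℝ) := by
  rw [cocompact_eq_atBot_atTop, Asymptotics.isBigO_sup]
  constructor
  · refine Asymptotics.IsBigO.of_norm_eventuallyLE ?_
    filter_upwards [eventually_le_atBot 0] with y hy
    rw [lerchPoisson_of_nonpos hs a hy, norm_zero]
    positivity
  · have hb : 0 < 2 * Real.pi * a.im := by have := Real.pi_pos; positivity
    have h := (isLittleO_exp_neg_mul_rpow_atTop hb (-2 - (s.re - 1))).isBigO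
    have h2 := (Asymptotics.isBigO_refl (fun y : ℝ => y ^ (s.re - 1)) atTop).mul h
    refine (Asymptotics.IsBigO.of_norm_eventuallyLE ?_).trans (h2.congr' .rfl ?_)
    · filter_upwards [eventually_gt_atTop 0] with y hy
      rw [lerchPoisson, max_eq_left hy.le, norm_mul, norm_cpow_eq_rpow_re_of_pos hy, norm_exp]
      simp
    · filter_upwards [eventually_gt_atTop 0] with y hy
      rw [← Real.rpow_add hy, abs_of_pos hy]
      ring_nf

/-- This is the Gamma integral with scale $2\pi i(x-a)$, whose real part is $2\pi\,\Im a>0$. -/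
lemma fourier_lerchPoisson {s a : ℂ} (hs : 1 < s.re) (ha : 0 < a.im) (x : ℝ) :
    𝓕 (lerchPoisson s a) x = (2 * Real.pi * I * (x - a)) ^ (-s) * Gamma s := by
  have hre : 0 < (2 * Real.pi * I * (x - a)).re := by
    have := Real.pi_pos
    simp; positivity
  rw [Real.fourier_real_eq_integral_exp_smul, ← lerchMellin_zero (by linarith) hre, lerchMellin,
    ← setIntegral_eq_integral_of_forall_compl_eq_zero (s := Ioi 0)]
  · refine setIntegral_congr_fun measurableSet_Ioi fun t ht => ?_
    simp only [lerchKernel, lerchPoisson, max_eq_left (le_of_lt (mem_Ioi.1 ht)), zero_mul, sub_zero,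
      div_one, smul_eq_mul]
    rw [mul_left_comm, ← Complex.exp_add]
    congr 2
    push_cast
    ring
  · intro t ht
    rw [lerchPoisson_of_nonpos hs a (not_lt.1 ht), smul_zero]

/-- The right-hand side of the transformation formula, with the Gamma factor absorbed in the
Mellin integrals; `p = (s, a, c)`. -/
noncomputable def lerchDual (p : ℂ × ℂ × ℂ) : ℂ :=
  (2 * Real.pi : ℂ) ^ (-p.1) *
    (exp (Real.pi * I * p.1 / 2) * exp (-2 * Real.pi * I * p.2.1 * p.2.2) *
        lerchMellin (p.1, lerchNome (1 - p.2.2), p.2.1) +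
      exp (-(Real.pi * I * p.1 / 2)) * exp (2 * Real.pi * I * p.2.2 * (1 - p.2.1)) *
        lerchMellin (p.1, lerchNome p.2.2, 1 - p.2.1))

lemma norm_lerchNome_ofReal (x : ℝ) : ‖lerchNome x‖ = 1 := by simp [norm_lerchNome]

lemma hasSum_fourier_lerchPoisson {s a : ℂ} (hs : 1 < s.re) (ha : 0 < a.im) (h0 : 0 < a.re)
    (h1 : a.re < 1) (x : ℝ) :
    HasSum (fun n : ℤ => 𝓕 (lerchPoisson s a) n * fourier n (x : UnitAddCircle))
      (exp (2 * Real.pi * I * a * x) * lerchDual (s, a, x)) := by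
  -- After this reflection the index $n\ge 0$ is the frequency $-n$, giving $-2\pi i(n+a)$, and the
  -- index $-(n+1)$ is the frequency $n+1$, giving $2\pi i(n+(1-a))$. Both $n+a$ and $n+(1-a)$ have
  -- positive real part.
  rw [← (Equiv.neg ℤ).hasSum_iff]
  have hA := (hasSum_lerchMellin_of_one_lt_re hs h0 (norm_lerchNome_ofReal (1 - x))).mul_left
    ((2 * Real.pi : ℂ) ^ (-s) * exp (Real.pi * I * s / 2))
  have hB := (hasSum_lerchMellin_of_one_lt_re (c := 1 - a) hs (by simpa using h1)
    (norm_lerchNome_ofReal x)).mul_left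
    ((2 * Real.pi : ℂ) ^ (-s) * exp (-(Real.pi * I * s / 2)) * exp (2 * Real.pi * I * x))
  convert! HasSum.of_nat_of_neg_add_one (hA.congr_fun ?_) (hB.congr_fun ?_) using 1
  · simp only [lerchDual, ofReal_sub, ofReal_one]
    have e1 : exp (2 * Real.pi * I * a * x) * exp (-2 * Real.pi * I * a * x) = 1 := by
      rw [← Complex.exp_add, ← Complex.exp_zero]; ring_nf
    have e2 : exp (2 * Real.pi * I * a * x) * exp (2 * Real.pi * I * x * (1 - a)) =
        exp (2 * Real.pi * I * x) := by
      rw [← Complex.exp_add]; ring_nf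
    rw [← e2]
    linear_combination ((2 * Real.pi : ℂ) ^ (-s) * exp (Real.pi * I * s / 2) *
      lerchMellin (s, lerchNome (1 - x), a)) * e1
  · intro n
    have hre : 0 < ((n : ℂ) + a).re := by simp; positivity
    simp only [Function.comp_apply, Equiv.neg_apply, fourier_lerchPoisson hs ha, fourier_coe_apply]
    -- Replacing $-x$ by $1-x$ in the exponential is free because $e^{2\pi i n}=1$.
    rw [show (2 * Real.pi * I * (((-(n : ℤ) : ℤ) : ℝ) - a) : ℂ) = -(2 * Real.pi * I * (n + a)) by
      push_cast; ring, neg_two_pi_I_mul_cpow_neg hre, lerchNome_pow,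
      show (2 * Real.pi * I * (-(n : ℤ) : ℤ) * x / (1 : ℝ) : ℂ) =
        2 * Real.pi * I * n * (1 - x : ℝ) - n * (2 * Real.pi * I) by push_cast; ring,
      Complex.exp_sub, exp_nat_mul_two_pi_mul_I]
    ring
  · intro n
    have hre : 0 < ((n : ℂ) + (1 - a)).re := by
      simp; linarith [n.cast_nonneg (α := ℝ)]
    simp only [Function.comp_apply, Equiv.neg_apply, fourier_lerchPoisson hs ha, fourier_coe_apply,
      neg_neg]
    rw [show (2 * Real.pi * I * ((((n : ℤ) + 1 : ℤ) : ℝ) - a) : ℂ) =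
      2 * Real.pi * I * (n + (1 - a)) by
      push_cast; ring, two_pi_I_mul_cpow_neg hre, lerchNome_pow,
      show (2 * Real.pi * I * ((n : ℤ) + 1 : ℤ) * x / (1 : ℝ) : ℂ) =
        2 * Real.pi * I * x + 2 * Real.pi * I * n * x by push_cast; ring,
      Complex.exp_add]
    ring

lemma hasSum_lerchPoisson {s a : ℂ} (hs : 1 < s.re) (ha : 0 < a.im) {x : ℝ} (hx0 : 0 < x)
    (hx1 : x < 1) :
    HasSum (fun n : ℤ => lerchPoisson s a (x + n))
      (exp (2 * Real.pi * I * a * x) * lerchSeries (1 - s) (lerchNome a) x) := by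
  rw [← add_zero (_ * _)]
  refine HasSum.of_nat_of_neg_add_one ?_ ?_
  · convert! (summable_lerchSeries (1 - s) (lerchNome_ne_zero a) (norm_lerchNome_lt_one ha)
      (c := x) (by simpa using hx0)).hasSum.mul_left (exp (2 * Real.pi * I * a * x)) using 2 with n
    rw [lerchPoisson, max_eq_left (by push_cast; positivity), lerchNome_pow, neg_sub,
      show (2 * Real.pi * I * a * ((x + (n : ℤ) : ℝ) : ℂ)) =
        2 * Real.pi * I * a * x + 2 * Real.pi * I * n * a by push_cast; ring, Complex.exp_add]
    push_cast
    rw [add_comm (x : ℂ)]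
    ring
  -- Translates by negative integers vanish because $x<1$.
  · convert! hasSum_zero using 2 with n
    refine lerchPoisson_of_nonpos hs a ?_
    push_cast
    linarith [n.cast_nonneg (α := ℝ)]

/-- The transformation formula in the region of absolute convergence. -/
lemma lerchSeries_eq_lerchDual_of_one_lt_re {s a : ℂ} (hs : 1 < s.re) (ha : 0 < a.im)
    (h0 : 0 < a.re) (h1 : a.re < 1) {x : ℝ} (hx0 : 0 < x) (hx1 : x < 1) :
    lerchSeries (1 - s) (lerchNome a) x = lerchDual (s, a, x) := by
  have hsum : Summable fun n : ℤ => 𝓕 (lerchPoisson s a) n := by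
    simpa using (hasSum_fourier_lerchPoisson hs ha h0 h1 0).summable
  have := Real.tsum_eq_tsum_fourier_of_rpow_decay_of_summable (continuous_lerchPoisson hs a)
    one_lt_two (isBigO_lerchPoisson hs ha) hsum x
  rw [(hasSum_lerchPoisson hs ha hx0 hx1).tsum_eq,
    (hasSum_fourier_lerchPoisson hs ha h0 h1 x).tsum_eq] at this
  exact mul_left_cancel₀ (exp_ne_zero _) this

/-! ### Extension of the identity to complex parameters. -/

lemma differentiable_lerchNome : Differentiable ℂ lerchNome := by
  unfold lerchNome; fun_prop

lemma isOpen_extendedPolycylinder : IsOpen extendedPolycylinder := by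
  have h (f : ℂ × ℂ × ℂ → ℂ) (hf : Continuous f) : IsOpen {p | 0 < (f p).re ∧ (f p).re < 1} :=
    (isOpen_lt continuous_const (continuous_re.comp hf)).inter
      (isOpen_lt (continuous_re.comp hf) continuous_const)
  exact (h _ (continuous_fst.comp continuous_snd)).inter (h _ (continuous_snd.comp continuous_snd))

/-- The vertical strip `0 < Re z < 1`. -/
def unitStrip : Set ℂ := {z | 0 < z.re ∧ z.re < 1}

lemma isOpen_unitStrip : IsOpen unitStrip :=
  (isOpen_lt continuous_const continuous_re).inter (isOpen_lt continuous_re continuous_const)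

lemma isPreconnected_unitStrip : IsPreconnected unitStrip :=
  ((convex_halfSpace_re_gt 0).inter (convex_halfSpace_re_lt 1)).isPreconnected

lemma one_sub_mem_unitStrip {z : ℂ} (hz : z ∈ unitStrip) : 1 - z ∈ unitStrip := by
  obtain ⟨h0, h1⟩ := hz
  constructor <;> simp <;> linarith

/-- Holomorphic functions on the strip `0 < Re z < 1` that agree where `Im z > 0` are equal. -/
lemma eqOn_unitStrip_of_im_pos {f g : ℂ → ℂ} (hf : DifferentiableOn ℂ f unitStrip)
    (hg : DifferentiableOn ℂ g unitStrip) (h : ∀ z ∈ unitStrip, 0 < z.im → f z = g z) :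
    EqOn f g unitStrip := by
  have hz : (⟨1 / 2, 1⟩ : ℂ) ∈ unitStrip := by constructor <;> norm_num
  refine (hf.analyticOnNhd isOpen_unitStrip).eqOn_of_preconnected_of_eventuallyEq
    (hg.analyticOnNhd isOpen_unitStrip) isPreconnected_unitStrip hz ?_
  filter_upwards [isOpen_unitStrip.mem_nhds hz,
    (isOpen_lt continuous_const continuous_im).mem_nhds (show (0 : ℝ) < (⟨1 / 2, 1⟩ : ℂ).im by simp)]
    with w h1 h2 using h w h1 h2

lemma differentiableAt_lerchMellin_nome {s a c : ℂ} (hs : 0 < s.re) (ha : a ∈ unitStrip)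
    (hc : 0 < c.re) :
    DifferentiableAt ℂ (fun p : ℂ × ℂ × ℂ => lerchMellin (p.1, lerchNome p.2.1, p.2.2))
      (s, a, c) :=
  DifferentiableAt.comp (g := lerchMellin)
    (f := fun p : ℂ × ℂ × ℂ => (p.1, lerchNome p.2.1, p.2.2)) (s, a, c)
    (differentiableAt_lerchMellin (p := (s, lerchNome a, c)) hs
      (one_sub_lerchNome_mem_slitPlane ha.1 ha.2) hc)
    (differentiableAt_fst.prodMk ((differentiable_lerchNome.differentiableAt.comp _
      (by fun_prop)).prodMk (by fun_prop)))

lemma differentiableAt_lerchDual {s a c : ℂ} (hs : 0 < s.re) (ha : a ∈ unitStrip)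
    (hc : c ∈ unitStrip) : DifferentiableAt ℂ lerchDual (s, a, c) := by
  have hpi := Real.pi_pos
  have h1 : DifferentiableAt ℂ (fun p : ℂ × ℂ × ℂ => lerchMellin (p.1, lerchNome (1 - p.2.2), p.2.1))
      (s, a, c) :=
    DifferentiableAt.comp (g := fun p : ℂ × ℂ × ℂ => lerchMellin (p.1, lerchNome p.2.1, p.2.2))
      (f := fun p : ℂ × ℂ × ℂ => (p.1, 1 - p.2.2, p.2.1)) (s, a, c)
      (differentiableAt_lerchMellin_nome hs (one_sub_mem_unitStrip hc) ha.1) (by fun_prop)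
  have h2 : DifferentiableAt ℂ (fun p : ℂ × ℂ × ℂ => lerchMellin (p.1, lerchNome p.2.2, 1 - p.2.1))
      (s, a, c) :=
    DifferentiableAt.comp (g := fun p : ℂ × ℂ × ℂ => lerchMellin (p.1, lerchNome p.2.1, p.2.2))
      (f := fun p : ℂ × ℂ × ℂ => (p.1, p.2.2, 1 - p.2.1)) (s, a, c)
      (differentiableAt_lerchMellin_nome hs hc (one_sub_mem_unitStrip ha).1) (by fun_prop)
  have h3 : DifferentiableAt ℂ (fun p : ℂ × ℂ × ℂ => (2 * Real.pi : ℂ) ^ (-p.1)) (s, a, c) :=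
    DifferentiableAt.const_cpow (by fun_prop) (Or.inl (by simp [hpi.ne']))
  unfold lerchDual
  exact h3.mul ((DifferentiableAt.mul (by fun_prop) h1).add (DifferentiableAt.mul (by fun_prop) h2))

/-- Two one-variable continuations: in $c$ from real points near $1/2$, and, at each such point, in
$s$ from real points near $2$. -/
lemma lerchSeries_eq_lerchDual {s a c : ℂ} (hs : 0 < s.re) (ha : a ∈ unitStrip) (ha' : 0 < a.im)
    (hc : c ∈ unitStrip) : lerchSeries (1 - s) (lerchNome a) c = lerchDual (s, a, c) := by
  have hhalf : (((1 / 2 : ℝ)) : ℂ) ∈ unitStrip := by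
    constructor <;> rw [ofReal_re] <;> norm_num
  have hq0 := lerchNome_ne_zero a
  have hq1 := norm_lerchNome_lt_one ha'
  refine ((differentiableOn_lerchSeries_shift (1 - s) hq0 hq1).mono
    fun z hz => hz.1).analyticOnNhd isOpen_unitStrip |>.eqOn_of_preconnected_of_frequently_eq
    (g := fun c => lerchDual (s, a, c)) (DifferentiableOn.analyticOnNhd ?_ isOpen_unitStrip)
    isPreconnected_unitStrip hhalf (frequently_ofReal_nhdsNE _ ?_) hc
  · intro z hz
    exact (DifferentiableAt.comp (g := lerchDual) (f := fun z : ℂ => (s, a, z)) z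
      (differentiableAt_lerchDual hs ha hz) (by fun_prop)).differentiableWithinAt
  · filter_upwards [Ioo_mem_nhds (show (0 : ℝ) < 1 / 2 by norm_num)
      (show (1 / 2 : ℝ) < 1 by norm_num)] with x hx
    have hx' : (x : ℂ) ∈ unitStrip := by simpa [unitStrip] using hx
    refine AnalyticOnNhd.eqOn_of_preconnected_of_frequently_eq
      (f := fun s => lerchSeries (1 - s) (lerchNome a) x) (g := fun s => lerchDual (s, a, x))
      (U := {s | 0 < s.re}) (z₀ := ((2 : ℝ) : ℂ)) (DifferentiableOn.analyticOnNhd ?_ isOpen_re_pos)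
      (DifferentiableOn.analyticOnNhd ?_ isOpen_re_pos) isPreconnected_re_pos (by simp)
      (frequently_ofReal_nhdsNE _ ?_) hs
    · exact ((differentiable_lerchSeries_exponent hq0 hq1 hx'.1).comp
        (differentiable_id.const_sub 1)).differentiableOn
    · intro z hz
      exact (DifferentiableAt.comp (g := lerchDual) (f := fun z : ℂ => (z, a, (x : ℂ))) z
        (differentiableAt_lerchDual hz ha hx') (by fun_prop)).differentiableWithinAt
    · filter_upwards [lt_mem_nhds one_lt_two] with r hr
      exact lerchSeries_eq_lerchDual_of_one_lt_re (by simpa using hr) ha' ha.1 ha.2 hx.1 hx.2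

/-- In the critical strip the Mellin integral and the dual expression agree. -/
lemma lerchMellin_div_Gamma_eq_lerchDual {s a c : ℂ} (hs : s ∈ unitStrip) (ha : a ∈ unitStrip)
    (hc : c ∈ unitStrip) :
    lerchMellin (s, lerchNome a, c) / Gamma s = lerchDual (1 - s, a, c) := by
  refine eqOn_unitStrip_of_im_pos (f := fun a => lerchMellin (s, lerchNome a, c) / Gamma s)
    (g := fun a => lerchDual (1 - s, a, c)) ?_ ?_ ?_ ha
  · intro z hz
    exact ((DifferentiableAt.comp
      (g := fun p : ℂ × ℂ × ℂ => lerchMellin (p.1, lerchNome p.2.1, p.2.2))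
      (f := fun z : ℂ => (s, z, c)) z
      (differentiableAt_lerchMellin_nome hs.1 hz hc.1) (by fun_prop)).div_const
        _).differentiableWithinAt
  · intro z hz
    exact (DifferentiableAt.comp (g := lerchDual) (f := fun z : ℂ => (1 - s, z, c)) z
      (differentiableAt_lerchDual (one_sub_mem_unitStrip hs).1 hz hc)
      (by fun_prop)).differentiableWithinAt
  · intro z hz hz'
    rw [← lerchSeries_eq_lerchDual (one_sub_mem_unitStrip hs).1 hz hz' hc, sub_sub_cancel,
      lerchMellin_eq_lerchSeries hs.1 (lerchNome_ne_zero z) (norm_lerchNome_lt_one hz') hc.1,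
      mul_div_cancel_left₀ _ (Gamma_ne_zero_of_re_pos hs.1)]

/-! ### Gluing and uniqueness of the continuation. -/

/-- The analytic continuation of the Lerch series to the extended polycylinder. -/
noncomputable def lerchContinuation (p : ℂ × ℂ × ℂ) : ℂ :=
  if 0 < p.1.re then lerchMellin (p.1, lerchNome p.2.1, p.2.2) / Gamma p.1
  else lerchDual (1 - p.1, p.2.1, p.2.2)

lemma lerchContinuation_of_re_pos {s : ℂ} (hs : 0 < s.re) (a c : ℂ) :
    lerchContinuation (s, a, c) = lerchMellin (s, lerchNome a, c) / Gamma s := if_pos hs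

lemma lerchContinuation_of_re_lt_one {s a c : ℂ} (hs : s.re < 1) (ha : a ∈ unitStrip)
    (hc : c ∈ unitStrip) : lerchContinuation (s, a, c) = lerchDual (1 - s, a, c) := by
  by_cases h : 0 < s.re
  · rw [lerchContinuation_of_re_pos h, lerchMellin_div_Gamma_eq_lerchDual ⟨h, hs⟩ ha hc]
  · exact if_neg h

lemma differentiableAt_lerchContinuation {p : ℂ × ℂ × ℂ} (hp : p ∈ extendedPolycylinder) :
    DifferentiableAt ℂ lerchContinuation p := by
  obtain ⟨s, a, c⟩ := p
  obtain ⟨ha, hc⟩ := hp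
  by_cases hs : 0 < s.re
  · have hG : DifferentiableAt ℂ (fun p : ℂ × ℂ × ℂ => (Gamma p.1)⁻¹) (s, a, c) :=
      DifferentiableAt.comp (g := fun z : ℂ => (Gamma z)⁻¹) (f := Prod.fst) (s, a, c)
        (differentiable_one_div_Gamma s) (by fun_prop)
    refine ((differentiableAt_lerchMellin_nome hs ha hc.1).mul hG).congr_of_eventuallyEq ?_
    filter_upwards [(isOpen_re_pos.preimage continuous_fst).mem_nhds
      (show (s, a, c) ∈ Prod.fst ⁻¹' {z : ℂ | 0 < z.re} from hs)] with p hp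
    rw [show p = (p.1, p.2.1, p.2.2) from rfl, lerchContinuation_of_re_pos hp, div_eq_mul_inv]
    rfl
  · have hD : DifferentiableAt ℂ (fun p : ℂ × ℂ × ℂ => lerchDual (1 - p.1, p.2.1, p.2.2))
        (s, a, c) :=
      DifferentiableAt.comp (g := lerchDual) (f := fun p : ℂ × ℂ × ℂ => (1 - p.1, p.2.1, p.2.2))
        (s, a, c) (differentiableAt_lerchDual (by simp; linarith) ha hc) (by fun_prop)
    refine hD.congr_of_eventuallyEq ?_
    have hopen : IsOpen {p : ℂ × ℂ × ℂ | p.1.re < 1} :=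
      isOpen_lt (continuous_re.comp continuous_fst) continuous_const
    filter_upwards [hopen.mem_nhds (show s.re < 1 by linarith),
      isOpen_extendedPolycylinder.mem_nhds (show (s, a, c) ∈ extendedPolycylinder from ⟨ha, hc⟩)]
      with p hp hp'
    exact lerchContinuation_of_re_lt_one hp hp'.1 hp'.2

lemma lerchContinuation_eq_lerchSeries {s a c : ℂ} (ha : a ∈ unitStrip) (ha' : 0 < a.im)
    (hc : c ∈ unitStrip) : lerchContinuation (s, a, c) = lerchSeries s (lerchNome a) c := by
  by_cases hs : 0 < s.re
  · rw [lerchContinuation_of_re_pos hs, lerchMellin_eq_lerchSeries hs (lerchNome_ne_zero a)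
      (norm_lerchNome_lt_one ha') hc.1, mul_div_cancel_left₀ _ (Gamma_ne_zero_of_re_pos hs)]
  · rw [lerchContinuation_of_re_lt_one (by linarith) ha hc,
      ← lerchSeries_eq_lerchDual (by simp; linarith) ha ha' hc, sub_sub_cancel]

lemma isLerchContinuation_lerchContinuation : IsLerchContinuation lerchContinuation := by
  refine ⟨fun p hp => (differentiableAt_lerchContinuation hp).differentiableWithinAt,
    fun s a c hp ha' => ?_⟩
  obtain ⟨ha, hc⟩ := hp
  rw [lerchContinuation_eq_lerchSeries ha ha' hc]
  convert! (summable_lerchSeries s (lerchNome_ne_zero a) (norm_lerchNome_lt_one ha') hc.1).hasSum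
    using 2 with n
  rw [lerchNome_pow, cpow_neg, div_eq_mul_inv]

/-- Continuation in $a$ alone suffices: for fixed $s$, $c$ both functions sum the same series where
$\Im a>0$. -/
lemma IsLerchContinuation.eqOn {Z W : ℂ × ℂ × ℂ → ℂ} (hZ : IsLerchContinuation Z)
    (hW : IsLerchContinuation W) : EqOn Z W extendedPolycylinder := by
  rintro ⟨s, a, c⟩ ⟨ha, hc⟩
  have hd {V : ℂ × ℂ × ℂ → ℂ} (hV : IsLerchContinuation V) :
      DifferentiableOn ℂ (fun z => V (s, z, c)) unitStrip :=
    hV.1.comp (f := fun z : ℂ => (s, z, c)) (by fun_prop) fun z hz => ⟨hz, hc⟩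
  exact eqOn_unitStrip_of_im_pos (hd hZ) (hd hW)
    (fun z hz hz' => (hZ.2 s z c ⟨hz, hc⟩ hz').unique (hW.2 s z c ⟨hz, hc⟩ hz')) ha

lemma isLerchContinuation_lerchZeta :
    IsLerchContinuation (fun p => lerchZeta p.1 p.2.1 p.2.2) :=
  Classical.epsilon_spec (p := IsLerchContinuation) ⟨_, isLerchContinuation_lerchContinuation⟩

lemma lerchZeta_eq_lerchContinuation {s a c : ℂ} (ha : a ∈ unitStrip) (hc : c ∈ unitStrip) :
    lerchZeta s a c = lerchContinuation (s, a, c) :=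
  isLerchContinuation_lerchZeta.eqOn isLerchContinuation_lerchContinuation
    (show (s, a, c) ∈ extendedPolycylinder from ⟨ha, hc⟩)

/-! ### The transformation formula and its limits at the poles. -/

lemma differentiable_lerchZeta_exponent {a c : ℂ} (ha : a ∈ unitStrip) (hc : c ∈ unitStrip) :
    Differentiable ℂ fun s => lerchZeta s a c := by
  have : (fun s => lerchZeta s a c) = fun s => lerchContinuation (s, a, c) :=
    funext fun s => lerchZeta_eq_lerchContinuation ha hc
  rw [this]
  intro s
  exact DifferentiableAt.comp (g := lerchContinuation) (f := fun z : ℂ => (z, a, c)) s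
    (differentiableAt_lerchContinuation ⟨ha, hc⟩) (by fun_prop)

/-- The transformation formula multiplied by `1 / Γ(s)`, an identity of entire functions of `s`. -/
lemma lerchZeta_one_sub_div_Gamma {a c : ℂ} (ha : a ∈ unitStrip) (hc : c ∈ unitStrip) (s : ℂ) :
    lerchZeta (1 - s) a c * (Gamma s)⁻¹ = (2 * Real.pi : ℂ) ^ (-s) *
      (exp (Real.pi * I * s / 2) * exp (-2 * Real.pi * I * a * c) * lerchZeta s (1 - c) a +
      exp (-(Real.pi * I * s / 2)) * exp (2 * Real.pi * I * c * (1 - a)) *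
        lerchZeta s c (1 - a)) := by
  have hpi := Real.pi_pos
  have ha₁ := one_sub_mem_unitStrip ha
  have hc₁ := one_sub_mem_unitStrip hc
  have d1 := differentiable_lerchZeta_exponent hc₁ ha
  have d2 := differentiable_lerchZeta_exponent hc ha₁
  have d3 : Differentiable ℂ fun s : ℂ => (2 * Real.pi : ℂ) ^ (-s) :=
    fun s => differentiableAt_id.neg.const_cpow (Or.inl (by simp [hpi.ne']))
  have hL : Differentiable ℂ fun s => lerchZeta (1 - s) a c * (Gamma s)⁻¹ :=
    ((differentiable_lerchZeta_exponent ha hc).comp (differentiable_id.const_sub 1)).mul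
      differentiable_one_div_Gamma
  have hR : Differentiable ℂ fun s : ℂ => (2 * Real.pi : ℂ) ^ (-s) *
      (exp (Real.pi * I * s / 2) * exp (-2 * Real.pi * I * a * c) * lerchZeta s (1 - c) a +
      exp (-(Real.pi * I * s / 2)) * exp (2 * Real.pi * I * c * (1 - a)) *
        lerchZeta s c (1 - a)) :=
    d3.mul ((Differentiable.mul (by fun_prop) d1).add (Differentiable.mul (by fun_prop) d2))
  refine congrFun (AnalyticOnNhd.eq_of_eventuallyEq (z₀ := 1)
    (analyticOnNhd_univ_iff_differentiable.2 hL) (analyticOnNhd_univ_iff_differentiable.2 hR) ?_) s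
  -- On $\Re z>0$ the continuation at $1-z$ is `lerchDual` at $z$, and those on the right are Mellin
  -- integrals over $\Gamma(z)$, so the identity is immediate.
  filter_upwards [isOpen_re_pos.mem_nhds (show 0 < (1 : ℂ).re by simp)] with z hz
  have hz' : 0 < z.re := hz
  rw [lerchZeta_eq_lerchContinuation ha hc, lerchZeta_eq_lerchContinuation hc₁ ha,
    lerchZeta_eq_lerchContinuation hc ha₁, lerchContinuation_of_re_lt_one (by simpa using hz') ha hc,
    lerchContinuation_of_re_pos hz, lerchContinuation_of_re_pos hz, sub_sub_cancel]
  simp only [lerchDual]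
  ring

lemma lerchZeta_one_sub {s a c : ℂ} (ha : a ∈ unitStrip) (hc : c ∈ unitStrip)
    (hs : ∀ m : ℕ, s ≠ -(m : ℂ)) : lerchZeta (1 - s) a c = lerchTransform s a c := by
  have hG := Gamma_ne_zero hs
  have h := lerchZeta_one_sub_div_Gamma ha hc s
  rw [← div_eq_mul_inv, div_eq_iff hG] at h
  rw [h, lerchTransform]
  ring

lemma eventually_ne_neg_natCast (m : ℕ) :
    ∀ᶠ z : ℂ in 𝓝 (-(m : ℂ)), z ≠ -(m : ℂ) → ∀ k : ℕ, z ≠ -(k : ℂ) := by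
  -- Distinct poles are at distance at least $1$.
  filter_upwards [Metric.ball_mem_nhds (-(m : ℂ)) one_pos] with z hz hne k hk
  rw [mem_ball_iff_norm, hk, show (-(k : ℂ) - -(m : ℂ)) = (((m : ℤ) - k : ℤ) : ℂ) by push_cast; ring,
    norm_intCast] at hz
  have h : |((m : ℤ) - k : ℤ)| < 1 := by exact_mod_cast hz
  have : m = k := by
    have := Int.abs_lt_one_iff.1 h
    omega
  exact hne (hk.trans (by rw [this]))

theorem mainTheorem6 :
    -- the Lerch zeta function continues analytically to the polycylinder, in exactly one way
    IsLerchContinuation (fun p => lerchZeta p.1 p.2.1 p.2.2) ∧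
    (∀ Z : ℂ × ℂ × ℂ → ℂ, IsLerchContinuation Z →
      ∀ s a c : ℂ, (s, a, c) ∈ extendedPolycylinder → Z (s, a, c) = lerchZeta s a c) ∧
    -- the transformation formula away from the poles of the Gamma function
    (∀ s a c : ℂ, (s, a, c) ∈ extendedPolycylinder → (∀ m : ℕ, s ≠ -(m : ℂ)) →
      lerchZeta (1 - s) a c = lerchTransform s a c) ∧
    -- at a pole of the Gamma function the right-hand side has a removable singularity, and the
    -- formula holds for its limit
    (∀ (m : ℕ) (a c : ℂ), (-(m : ℂ), a, c) ∈ extendedPolycylinder →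
      Tendsto (fun p : ℂ × ℂ × ℂ => lerchTransform p.1 p.2.1 p.2.2)
        (𝓝[{p : ℂ × ℂ × ℂ | p.1 ≠ -(m : ℂ)}] (-(m : ℂ), a, c))
        (𝓝 (lerchZeta (1 - (-(m : ℂ))) a c))) := by
  refine ⟨isLerchContinuation_lerchZeta,
    fun Z hZ s a c hp => hZ.eqOn isLerchContinuation_lerchZeta hp,
    fun s a c hp hs => lerchZeta_one_sub hp.1 hp.2 hs, fun m a c hp => ?_⟩
  -- The left side is continuous at the pole in all three variables and equals the right side at
  -- nearby points with $s\ne -m$, so it is the limit.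
  have hcont : ContinuousAt (fun p : ℂ × ℂ × ℂ => lerchZeta (1 - p.1) p.2.1 p.2.2)
      (-(m : ℂ), a, c) :=
    ContinuousAt.comp (g := fun p : ℂ × ℂ × ℂ => lerchZeta p.1 p.2.1 p.2.2)
      (f := fun p : ℂ × ℂ × ℂ => (1 - p.1, p.2.1, p.2.2))
      (isLerchContinuation_lerchZeta.1.continuousOn.continuousAt
        (isOpen_extendedPolycylinder.mem_nhds ⟨hp.1, hp.2⟩)) (by fun_prop)
  refine (hcont.tendsto.mono_left nhdsWithin_le_nhds).congr' ?_
  filter_upwards [self_mem_nhdsWithin,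
    nhdsWithin_le_nhds (isOpen_extendedPolycylinder.mem_nhds hp),
    nhdsWithin_le_nhds (continuousAt_fst.eventually (eventually_ne_neg_natCast m))]
    with p hne hp' hk
  exact lerchZeta_one_sub hp'.1 hp'.2 (hk hne)
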